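/- Let $\Omega\subset\mathbb R^N$ be open and bounded, and let its boundary be the disjoint union of three parts $\Gamma_1,\Gamma_2,\Gamma_3$. Let $n$ denote the outward unit normal; a condition $\partial f/\partial n=0$ on $\Gamma_3$ means that, at every point of $\Gamma_3$ where the boundary has an outward unit normal, the one-sided normal derivative of $f$ from inside $\Omega$ exists and vanishes. Assume that the boundary is regular enough that the mixed problem $$\Delta z=0\ \text{in }\Omega,\qquad z=0\ \text{on }\Gamma_1,\qquad z=1\ \text{on }\Gamma_2,\qquad \frac{\partial z}{\partial n}=0\ \text{on }\Gamma_3$$ has one and only one classical solution $z\in C^2(\Omega)\cap C^0(\overline\Omega)$. Let $u_1,u_2,w_1,w_2\in\mathbb R$ with $w_1<w_2$, let $R$ be the closed rectangle of all $(u,w)$ with $u$ between $u_1$ and $u_2$ and $w_1\le w\le w_2$, and let $a,b$ be continuous and strictly positive on $R$. Consider the system $$\nabla\cdot(a(u,w)\nabla u)=0\ \text{in }\Omega,\qquad u=u_1\ \text{on }\Gamma_1,\quad u=u_2\ \text{on }\Gamma_2,\quad \frac{\partial u}{\partial n}=0\ \text{on }\Gamma_3,$$ $$\nabla\cdot(b(u,w)\nabla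 w)=0\ \text{in }\Omega,\qquad w=w_1\ \text{on }\Gamma_1,\quad w=w_2\ \text{on }\Gamma_2,\quad \frac{\partial w}{\partial n}=0\ \text{on }\Gamma_3.$$ A classical solution is a pair $(u,w)$ of functions in $C^1(\Omega)\cap C^0(\overline\Omega)$, with values in $R$ and with fluxes $a(u,w)\nabla u,\ b(u,w)\nabla w\in C^1(\Omega)$, that satisfies these equations and boundary conditions. It is called functional if there is a function $U\in C^1([w_1,w_2])$ with $u(x)=U(w(x))$ for all $x\in\overline\Omega$. Suppose that the two-point problem $$U'(t)=\gamma\,\frac{b(U(t),t)}{a(U(t),t)}\quad (w_1\le t\le w_2),\qquad U(w_1)=u_1,\qquad U(w_2)=u_2,$$ in the unknowns $\gamma\in\mathbb R$ and $U\in C^1([w_1,w_2])$ with $(U(t),t)\in R$ for all $t\in[w_1,w_2]$, has one and only one solution $(\gamma,U)$. Then the system has at most one functional solution: if $(u,w)$ and $(u',w')$ are functional solutions, then $u=u'$ and $w=w'$ on $\overline\Omega$. -/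

import Mathlib

/-- `ν` is the outward unit normal to the boundary of `Ω` at `x`: close to `x`, every cone with
axis `-ν` and opening less than a half-space lies in `Ω`, and every such cone with axis `ν` lies
outside `Ω`. -/
def IsOutwardUnitNormal {N : ℕ} (Ω : Set (EuclideanSpace ℝ (Fin N)))
    (x ν : EuclideanSpace ℝ (Fin N)) : Prop :=
  x ∈ frontier Ω ∧ ‖ν‖ = 1 ∧
    ∀ ε : ℝ, 0 < ε → ∃ δ : ℝ, 0 < δ ∧ ∀ y : EuclideanSpace ℝ (Fin N), ‖y - x‖ < δ →
      (inner ℝ (y - x) ν < -(ε * ‖y - x‖) → y ∈ Ω) ∧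
      (ε * ‖y - x‖ < inner ℝ (y - x) ν → y ∉ Ω)

/-- `∂f/∂n = 0` on the part `S` of the boundary of `Ω`: at every point of `S` at which the boundary
has an outward unit normal `ν`, the one-sided derivative of `f` along the inner normal exists and
vanishes. (The points `x - t • ν` with small `t > 0` lie in `Ω`.) -/
def NormalDerivZeroOn {N : ℕ} (Ω S : Set (EuclideanSpace ℝ (Fin N)))
    (f : EuclideanSpace ℝ (Fin N) → ℝ) : Prop :=
  ∀ x ∈ S, ∀ ν : EuclideanSpace ℝ (Fin N), IsOutwardUnitNormal Ω x ν →
    HasDerivWithinAt (fun t : ℝ => f (x - t • ν)) 0 (Set.Ici 0) 0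

/-- The mixed boundary conditions: `f = c₁` on `Γ₁`, `f = c₂` on `Γ₂`, `∂f/∂n = 0` on `Γ₃`. -/
structure MixedBoundaryConditions {N : ℕ} (Ω Γ₁ Γ₂ Γ₃ : Set (EuclideanSpace ℝ (Fin N)))
    (c₁ c₂ : ℝ) (f : EuclideanSpace ℝ (Fin N) → ℝ) : Prop where
  on_first : ∀ x ∈ Γ₁, f x = c₁
  on_second : ∀ x ∈ Γ₂, f x = c₂
  on_third : NormalDerivZeroOn Ω Γ₃ f

/-- `z` is a classical solution of `Δz = 0` in `Ω`, `z = 0` on `Γ₁`, `z = 1` on `Γ₂`,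
`∂z/∂n = 0` on `Γ₃`. -/
structure IsMixedSolution {N : ℕ} (Ω Γ₁ Γ₂ Γ₃ : Set (EuclideanSpace ℝ (Fin N)))
    (z : EuclideanSpace ℝ (Fin N) → ℝ) : Prop where
  continuousOn : ContinuousOn z (closure Ω)
  contDiffOn : ContDiffOn ℝ 2 z Ω
  laplacian_eq_zero : ∀ x ∈ Ω, Laplacian.laplacian z x = 0
  boundary : MixedBoundaryConditions Ω Γ₁ Γ₂ Γ₃ 0 1 z

/-- The mixed problem for the Laplace equation has one and only one classical solution (functions
are compared on the closure of `Ω`). -/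
def MixedProblemUniquelySolvable {N : ℕ} (Ω Γ₁ Γ₂ Γ₃ : Set (EuclideanSpace ℝ (Fin N))) : Prop :=
  ∃ z : EuclideanSpace ℝ (Fin N) → ℝ, IsMixedSolution Ω Γ₁ Γ₂ Γ₃ z ∧
    ∀ z' : EuclideanSpace ℝ (Fin N) → ℝ, IsMixedSolution Ω Γ₁ Γ₂ Γ₃ z' →
      Set.EqOn z' z (closure Ω)

/-- The divergence of a vector field: the trace of its derivative. -/
noncomputable def divergence {N : ℕ}
    (F : EuclideanSpace ℝ (Fin N) → EuclideanSpace ℝ (Fin N))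
    (x : EuclideanSpace ℝ (Fin N)) : ℝ :=
  LinearMap.trace ℝ (EuclideanSpace ℝ (Fin N)) (fderiv ℝ F x).toLinearMap

/-- The flux `c(u, w) ∇f`. -/
noncomputable def flux {N : ℕ} (c : ℝ → ℝ → ℝ) (u w f : EuclideanSpace ℝ (Fin N) → ℝ)
    (x : EuclideanSpace ℝ (Fin N)) : EuclideanSpace ℝ (Fin N) :=
  c (u x) (w x) • gradient f x

/-- The closed rectangle of all `(u, w)` with `u` between `u₁` and `u₂` and `w₁ ≤ w ≤ w₂`, on which
the coefficients of the system live. -/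
def coefficientRectangle (u₁ u₂ w₁ w₂ : ℝ) : Set (ℝ × ℝ) :=
  Set.uIcc u₁ u₂ ×ˢ Set.Icc w₁ w₂

/-- `(u, w)` is a classical solution of the system `∇·(a(u,w)∇u) = 0`, `∇·(b(u,w)∇w) = 0` in `Ω`
with the mixed boundary conditions. The values of `(u, w)` lie in the rectangle on which the
coefficients are given, and the fluxes are continuously differentiable. -/
structure IsClassicalSolution {N : ℕ} (Ω Γ₁ Γ₂ Γ₃ : Set (EuclideanSpace ℝ (Fin N)))
    (a b : ℝ → ℝ → ℝ) (u₁ u₂ w₁ w₂ : ℝ) (u w : EuclideanSpace ℝ (Fin N) → ℝ) : Prop where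
  mem_rectangle : ∀ x ∈ closure Ω, (u x, w x) ∈ coefficientRectangle u₁ u₂ w₁ w₂
  continuousOn_u : ContinuousOn u (closure Ω)
  continuousOn_w : ContinuousOn w (closure Ω)
  contDiffOn_u : ContDiffOn ℝ 1 u Ω
  contDiffOn_w : ContDiffOn ℝ 1 w Ω
  contDiffOn_flux_u : ContDiffOn ℝ 1 (flux a u w u) Ω
  contDiffOn_flux_w : ContDiffOn ℝ 1 (flux b u w w) Ω
  equation_u : ∀ x ∈ Ω, divergence (flux a u w u) x = 0
  equation_w : ∀ x ∈ Ω, divergence (flux b u w w) x = 0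
  boundary_u : MixedBoundaryConditions Ω Γ₁ Γ₂ Γ₃ u₁ u₂ u
  boundary_w : MixedBoundaryConditions Ω Γ₁ Γ₂ Γ₃ w₁ w₂ w

/-- A classical solution `(u, w)` is functional if `u = U(w)` for some `U ∈ C¹([w₁, w₂])`. -/
def IsFunctionalSolution {N : ℕ} (Ω Γ₁ Γ₂ Γ₃ : Set (EuclideanSpace ℝ (Fin N)))
    (a b : ℝ → ℝ → ℝ) (u₁ u₂ w₁ w₂ : ℝ) (u w : EuclideanSpace ℝ (Fin N) → ℝ) : Prop :=
  IsClassicalSolution Ω Γ₁ Γ₂ Γ₃ a b u₁ u₂ w₁ w₂ u w ∧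
    ∃ U : ℝ → ℝ, ContDiffOn ℝ 1 U (Set.Icc w₁ w₂) ∧ ∀ x ∈ closure Ω, u x = U (w x)

/-- `(γ, U)` solves the two-point problem `U'(t) = γ b(U(t),t)/a(U(t),t)` on `[w₁, w₂]`,
`U(w₁) = u₁`, `U(w₂) = u₂`; the derivative is one-sided at the endpoints. -/
structure IsTwoPointSolution (a b : ℝ → ℝ → ℝ) (u₁ u₂ w₁ w₂ : ℝ) (γ : ℝ) (U : ℝ → ℝ) :
    Prop where
  mem_rectangle : ∀ t ∈ Set.Icc w₁ w₂, (U t, t) ∈ coefficientRectangle u₁ u₂ w₁ w₂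
  contDiffOn : ContDiffOn ℝ 1 U (Set.Icc w₁ w₂)
  equation : ∀ t ∈ Set.Icc w₁ w₂,
    HasDerivWithinAt U (γ * (b (U t) t / a (U t) t)) (Set.Icc w₁ w₂) t
  left_value : U w₁ = u₁
  right_value : U w₂ = u₂

/-- The two-point problem, in the unknowns `γ` and `U`, has one and only one solution. -/
def TwoPointProblemUniquelySolvable (a b : ℝ → ℝ → ℝ) (u₁ u₂ w₁ w₂ : ℝ) : Prop :=
  ∃ (γ : ℝ) (U : ℝ → ℝ), IsTwoPointSolution a b u₁ u₂ w₁ w₂ γ U ∧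
    ∀ (γ' : ℝ) (U' : ℝ → ℝ), IsTwoPointSolution a b u₁ u₂ w₁ w₂ γ' U' →
      γ' = γ ∧ Set.EqOn U' U (Set.Icc w₁ w₂)

/-!
The proof is a change of the dependent variable. Let `(u, w)` be a functional solution, `u = U ∘ w`,
and put `B(t) = ∫ b(U(s), s) ds` and `A(t) = ∫ a(U(s), s) U'(s) ds` on `[w₁, w₂]`. The gradients of
`B ∘ w` and `A ∘ w` are the two fluxes, so both functions are harmonic
(`contDiffOn_comp_and_laplacian_comp_eq_zero`), and they satisfy mixed boundary conditions. If `z`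
solves the mixed problem for the Laplace equation, uniqueness forces
`B ∘ w = B(w₁) + (B(w₂) - B(w₁)) z`, and likewise for `A`
(`MixedProblemUniquelySolvable.eqOn_affine`).

Suppose first that `z` attains every value in `[0, 1]`. As `B` is strictly increasing, `w` attains
every value in `[w₁, w₂]`, so that `A - A(w₁)` is a constant multiple `γ` of `B - B(w₁)` on the whole
interval; differentiating, `a U' = γ b`, that is, `(γ, U)` solves the two-point problem
(`IsClassicalSolution.isTwoPointSolution`). Hence two functional solutions have the same `U`, the
same `B`, and, `B` being injective, the same `w`.

Since `Ω` need not be connected, `z` may omit a value `c ∈ [0, 1]`. Then the indicator function of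
`{z > c}` is locally constant on the closure of `Ω` and solves the mixed problem too, so `z` takes
only the values `0` and `1` (`IsMixedSolution.step`). In that case `w` is `w₁` where `z = 0` and `w₂`
where `z = 1`, and `u` is `u₁` and `u₂` there, whatever `U` is.
-/

open Set Filter Topology

/-! ### Harmonic functions with mixed boundary conditions -/

section Harmonic

variable {N : ℕ} {Ω Γ₁ Γ₂ Γ₃ : Set (EuclideanSpace ℝ (Fin N))}

/-- The Laplacian is the divergence of the gradient. -/
lemma laplacian_eq_divergence_gradient {V : EuclideanSpace ℝ (Fin N) → ℝ}
    {x : EuclideanSpace ℝ (Fin N)} (hV : DifferentiableAt ℝ (gradient V) x) :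
    Laplacian.laplacian V x = divergence (gradient V) x := by
  have hfd : fderiv ℝ V = innerSL ℝ ∘ gradient V := by
    ext y v
    simp [inner_gradient_left]
  have hd : HasFDerivAt (innerSL ℝ ∘ gradient V) _ x :=
    (innerSL ℝ).hasFDerivAt.comp x hV.hasFDerivAt
  rw [divergence, LinearMap.trace_eq_sum_inner _ (stdOrthonormalBasis ℝ _),
    InnerProductSpace.laplacian_eq_iteratedFDeriv_stdOrthonormalBasis]
  refine Finset.sum_congr rfl fun i _ => ?_
  rw [iteratedFDeriv_two_apply, hfd, hd.fderiv]
  exact real_inner_comm (F := EuclideanSpace ℝ (Fin N)) _ _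

/-- If the gradient of `F ∘ w` is a continuously differentiable field without divergence, then
`F ∘ w` is twice continuously differentiable and harmonic. -/
lemma contDiffOn_comp_and_laplacian_comp_eq_zero (hΩ : IsOpen Ω) {F f : ℝ → ℝ}
    (hF : ∀ t, HasDerivAt F (f t) t) {w : EuclideanSpace ℝ (Fin N) → ℝ}
    (hw : ContDiffOn ℝ 1 w Ω) {G : EuclideanSpace ℝ (Fin N) → EuclideanSpace ℝ (Fin N)}
    (hG : ContDiffOn ℝ 1 G Ω) (hdiv : ∀ x ∈ Ω, divergence G x = 0)
    (hgrad : ∀ x ∈ Ω, f (w x) • gradient w x = G x) :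
    ContDiffOn ℝ 2 (F ∘ w) Ω ∧ ∀ x ∈ Ω, Laplacian.laplacian (F ∘ w) x = 0 := by
  have hd : ∀ x ∈ Ω, HasFDerivAt (F ∘ w) (innerSL ℝ (G x)) x := by
    intro x hx
    have h1 : DifferentiableAt ℝ w x :=
      (hw.differentiableOn one_ne_zero).differentiableAt (hΩ.mem_nhds hx)
    have h2 := (hF (w x)).comp_hasFDerivAt x h1.hasFDerivAt
    have h3 : innerSL ℝ (G x) = f (w x) • fderiv ℝ w x := by
      ext v
      simp [← hgrad x hx, inner_gradient_left]
    rwa [h3]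
  have hgradEq : EqOn (gradient (F ∘ w)) G Ω := fun x hx =>
    
    (hasGradientAt_iff_hasFDerivAt.2 (hd x hx)).gradient
  constructor
  · rw [show (2 : WithTop ℕ∞) = 1 + 1 by norm_num, contDiffOn_succ_iff_fderiv_of_isOpen hΩ]
    refine ⟨fun x hx => (hd x hx).differentiableAt.differentiableWithinAt, by simp, ?_⟩
    exact ((innerSL ℝ).contDiff.comp_contDiffOn hG).congr fun x hx => (hd x hx).fderiv
  · intro x hx
    have he : gradient (F ∘ w) =ᶠ[𝓝 x] G := hgradEq.eventuallyEq_of_mem (hΩ.mem_nhds hx)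
    have hGx : DifferentiableAt ℝ G x :=
      (hG.differentiableOn one_ne_zero).differentiableAt (hΩ.mem_nhds hx)
    rw [laplacian_eq_divergence_gradient (hGx.congr_of_eventuallyEq he), divergence, he.fderiv_eq]
    exact hdiv x hx

/-- Composition with a differentiable function of one variable preserves mixed boundary
conditions. -/
lemma MixedBoundaryConditions.comp {c₁ c₂ : ℝ} {w : EuclideanSpace ℝ (Fin N) → ℝ}
    (hw : MixedBoundaryConditions Ω Γ₁ Γ₂ Γ₃ c₁ c₂ w) {F f : ℝ → ℝ}
    (hF : ∀ t, HasDerivAt F (f t) t) :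
    MixedBoundaryConditions Ω Γ₁ Γ₂ Γ₃ (F c₁) (F c₂) (F ∘ w) where
  on_first x hx := by simp [hw.on_first x hx]
  on_second x hx := by simp [hw.on_second x hx]
  on_third x hx ν hν := by
    have h := hw.on_third x hx ν hν
    simpa [Function.comp_def] using (hF (w (x - (0 : ℝ) • ν))).comp_hasDerivWithinAt 0 h

/-- A harmonic function with mixed boundary values `c₁`, `c₂` is the corresponding affine function
of the solution of the mixed problem: the difference, added to that solution, gives another one. -/
lemma MixedProblemUniquelySolvable.eqOn_affine (hΩ : IsOpen Ω)
    (hmixed : MixedProblemUniquelySolvable Ω Γ₁ Γ₂ Γ₃) {z V : EuclideanSpace ℝ (Fin N) → ℝ}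
    (hz : IsMixedSolution Ω Γ₁ Γ₂ Γ₃ z) {c₁ c₂ : ℝ} (hVc : ContinuousOn V (closure Ω))
    (hV : ContDiffOn ℝ 2 V Ω) (hVΔ : ∀ x ∈ Ω, Laplacian.laplacian V x = 0)
    (hVb : MixedBoundaryConditions Ω Γ₁ Γ₂ Γ₃ c₁ c₂ V) :
    ∀ x ∈ closure Ω, V x = c₁ + (c₂ - c₁) * z x := by
  obtain ⟨z₀, -, huniq⟩ := hmixed
  set k : ℝ := 1 - c₂ + c₁ with hk
  have key : IsMixedSolution Ω Γ₁ Γ₂ Γ₃ ((k • z + V) + fun _ => -c₁) := by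
    refine ⟨((hz.continuousOn.const_smul k).add hVc).add continuousOn_const,
      ((hz.contDiffOn.const_smul k).add hV).add contDiffOn_const, ?_, ?_, ?_, ?_⟩
    · intro x hx
      have h1 : ContDiffAt ℝ 2 z x := hz.contDiffOn.contDiffAt (hΩ.mem_nhds hx)
      have h2 : ContDiffAt ℝ 2 V x := hV.contDiffAt (hΩ.mem_nhds hx)
      have h3 : ContDiffAt ℝ 2 (k • z) x := h1.const_smul k
      have h4 : ContDiffAt ℝ 2 (k • z + V) x := h3.add h2
      rw [h4.laplacian_add contDiffAt_const, h3.laplacian_add h2, InnerProductSpace.laplacian_smul k h1,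
        hz.laplacian_eq_zero x hx, hVΔ x hx]
      simp
    · intro x hx
      simp [hz.boundary.on_first x hx, hVb.on_first x hx]
    · intro x hx
      simp only [Pi.add_apply, Pi.smul_apply, smul_eq_mul, hz.boundary.on_second x hx,
        hVb.on_second x hx, hk]
      ring
    · intro x hx ν hν
      have h1 := hz.boundary.on_third x hx ν hν
      have h2 := hVb.on_third x hx ν hν
      simpa using ((h1.const_mul k).add h2).add_const (-c₁)
  intro x hx
  have h1 := (huniq _ key hx).trans (huniq _ hz hx).symm
  simp only [Pi.add_apply, Pi.smul_apply, smul_eq_mul, hk] at h1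
  linarith

/-- Close to a boundary point, the points on the inner normal lie in the domain. -/
lemma IsOutwardUnitNormal.eventually_mem_closure {x ν : EuclideanSpace ℝ (Fin N)}
    (hν : IsOutwardUnitNormal Ω x ν) :
    ∀ᶠ t : ℝ in 𝓝[Ici 0] 0, x - t • ν ∈ closure Ω := by
  obtain ⟨hx, hnorm, hcone⟩ := hν
  obtain ⟨δ, hδ, h⟩ := hcone (1 / 2) (by norm_num)
  filter_upwards [self_mem_nhdsWithin, mem_nhdsWithin_of_mem_nhds (Iio_mem_nhds hδ)] with t ht htδ
  rcases (show (0 : ℝ) ≤ t from ht).eq_or_lt with rfl | ht0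
  · simpa using frontier_subset_closure hx
  · refine subset_closure ((h (x - t • ν) ?_).1 ?_)
    · simpa [norm_smul, hnorm, abs_of_pos ht0] using htδ
    · have : inner ℝ (x - t • ν - x) ν = -t := by
        simp [inner_smul_left, hnorm]
      rw [this]
      simp only [sub_sub_cancel_left, norm_neg, norm_smul, hnorm, Real.norm_eq_abs,
        abs_of_pos ht0]
      linarith

/-- A function that is locally constant on the closure of `Ω` and has the right values on `Γ₁` and
`Γ₂` solves the mixed problem. -/
lemma isMixedSolution_of_locally_const (hΩ : IsOpen Ω) (hΓ₃ : Γ₃ ⊆ closure Ω)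
    {g : EuclideanSpace ℝ (Fin N) → ℝ}
    (hg : ∀ x ∈ closure Ω, ∀ᶠ y in 𝓝[closure Ω] x, g y = g x)
    (h₁ : ∀ x ∈ Γ₁, g x = 0) (h₂ : ∀ x ∈ Γ₂, g x = 1) : IsMixedSolution Ω Γ₁ Γ₂ Γ₃ g := by
  have hloc : ∀ x ∈ Ω, g =ᶠ[𝓝 x] fun _ => g x := fun x hx => by
    have := hg x (subset_closure hx)
    rwa [nhdsWithin_eq_nhds.2 (mem_of_superset (hΩ.mem_nhds hx) subset_closure)] at this
  refine ⟨fun x hx => ?_, fun x hx => ?_, fun x hx => ?_, h₁, h₂, fun x hx ν hν => ?_⟩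
  · exact (continuousWithinAt_const (b := g x)).congr_of_eventuallyEq (hg x hx) rfl
  · exact (contDiffAt_const.congr_of_eventuallyEq (hloc x hx)).contDiffWithinAt
  · rw [(InnerProductSpace.laplacian_congr_nhds (hloc x hx)).self_of_nhds]
    simp
  · have hcont : Tendsto (fun t : ℝ => x - t • ν) (𝓝[Ici 0] 0) (𝓝[closure Ω] x) := by
      refine tendsto_nhdsWithin_iff.2 ⟨?_, hν.eventually_mem_closure⟩
      have : Continuous fun t : ℝ => x - t • ν := by fun_prop
      simpa using (this.tendsto 0).mono_left nhdsWithin_le_nhds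
    refine (hasDerivWithinAt_const (0 : ℝ) (Ici 0) (g x)).congr_of_eventuallyEq
      (hcont.eventually (hg x (hΓ₃ hx))) (by simp)

/-- If a solution `z` of the mixed problem omits the value `c ∈ [0, 1]`, then the indicator function
of `{z > c}` solves the mixed problem as well. -/
lemma IsMixedSolution.step (hΩ : IsOpen Ω) (hΓ₃ : Γ₃ ⊆ closure Ω) (hΓ₂ : Γ₂ ⊆ closure Ω)
    {z : EuclideanSpace ℝ (Fin N) → ℝ} (hz : IsMixedSolution Ω Γ₁ Γ₂ Γ₃ z) {c : ℝ}
    (hc : c ∈ Icc (0 : ℝ) 1) (hne : ∀ x ∈ closure Ω, z x ≠ c) :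
    IsMixedSolution Ω Γ₁ Γ₂ Γ₃ fun x => if c < z x then 1 else 0 := by
  refine isMixedSolution_of_locally_const hΩ hΓ₃ (fun x hx => ?_) (fun x hx => ?_) fun x hx => ?_
  · rcases (hne x hx).lt_or_gt with h | h
    · filter_upwards [(hz.continuousOn x hx).eventually (gt_mem_nhds h)] with y hy
      simp [not_lt.2 hy.le, not_lt.2 h.le]
    · filter_upwards [(hz.continuousOn x hx).eventually (lt_mem_nhds h)] with y hy
      simp [hy, h]
  · simp [hz.boundary.on_first x hx, hc.1]
  · have h1 := hz.boundary.on_second x hx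
    have h2 := hne x (hΓ₂ hx)
    rw [h1] at h2
    simp [h1, lt_of_le_of_ne hc.2 h2.symm]

/-- If a solution of the mixed problem vanishes somewhere, then `Γ₁` is not empty: otherwise the
constant `1` would be another solution. -/
lemma MixedProblemUniquelySolvable.nonempty_first (hΩ : IsOpen Ω) (hΓ₃ : Γ₃ ⊆ closure Ω)
    (hmixed : MixedProblemUniquelySolvable Ω Γ₁ Γ₂ Γ₃) {z : EuclideanSpace ℝ (Fin N) → ℝ}
    (hz : IsMixedSolution Ω Γ₁ Γ₂ Γ₃ z) {x : EuclideanSpace ℝ (Fin N)} (hx : x ∈ closure Ω)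
    (h0 : z x = 0) : Γ₁.Nonempty := by
  by_contra hne
  obtain ⟨z₀, -, huniq⟩ := hmixed
  rw [not_nonempty_iff_eq_empty] at hne
  have h1 : IsMixedSolution Ω Γ₁ Γ₂ Γ₃ fun _ => 1 :=
    isMixedSolution_of_locally_const hΩ hΓ₃ (by simp) (by simp [hne]) (by simp)
  have := (huniq _ h1 hx).trans (huniq _ hz hx).symm
  simp [h0] at this

/-- If a solution of the mixed problem takes the value `1`, then `Γ₂` is not empty: otherwise the
constant `0` would be another solution. -/
lemma MixedProblemUniquelySolvable.nonempty_second (hΩ : IsOpen Ω) (hΓ₃ : Γ₃ ⊆ closure Ω)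
    (hmixed : MixedProblemUniquelySolvable Ω Γ₁ Γ₂ Γ₃) {z : EuclideanSpace ℝ (Fin N) → ℝ}
    (hz : IsMixedSolution Ω Γ₁ Γ₂ Γ₃ z) {x : EuclideanSpace ℝ (Fin N)} (hx : x ∈ closure Ω)
    (h1 : z x = 1) : Γ₂.Nonempty := by
  by_contra hne
  obtain ⟨z₀, -, huniq⟩ := hmixed
  rw [not_nonempty_iff_eq_empty] at hne
  have h0 : IsMixedSolution Ω Γ₁ Γ₂ Γ₃ fun _ => 0 :=
    isMixedSolution_of_locally_const hΩ hΓ₃ (by simp) (by simp) (by simp [hne])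
  have := (huniq _ h0 hx).trans (huniq _ hz hx).symm
  simp [h1] at this

end Harmonic

/-! ### The coefficients along the curve `u = U(w)` -/

section Curve

variable {u₁ u₂ w₁ w₂ : ℝ}

/-- The coefficient `c(U(t), t)`, with `U(t)` clamped to the interval between `u₁` and `u₂` and `t`
to `[w₁, w₂]`. The clamping makes it a continuous function on the line even if the curve `(U(t), t)`
leaves the rectangle at values `t` that `w` does not attain. -/
noncomputable def curveCoefficient (c : ℝ → ℝ → ℝ) (u₁ u₂ : ℝ) (hw : w₁ ≤ w₂) (U : ℝ → ℝ)
    (t : ℝ) : ℝ :=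
  c (projIcc (u₁ ⊓ u₂) (u₁ ⊔ u₂) inf_le_sup (U (projIcc w₁ w₂ hw t))) (projIcc w₁ w₂ hw t)

lemma curveCoefficient_mem (hw : w₁ ≤ w₂) (U : ℝ → ℝ) (t : ℝ) :
    ((projIcc (u₁ ⊓ u₂) (u₁ ⊔ u₂) inf_le_sup (U (projIcc w₁ w₂ hw t)) : ℝ),
      (projIcc w₁ w₂ hw t : ℝ)) ∈ coefficientRectangle u₁ u₂ w₁ w₂ :=
  ⟨Subtype.coe_prop (projIcc (u₁ ⊓ u₂) (u₁ ⊔ u₂) inf_le_sup _), Subtype.coe_prop _⟩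

lemma curveCoefficient_of_mem {c : ℝ → ℝ → ℝ} (hw : w₁ ≤ w₂) {U : ℝ → ℝ} {t : ℝ}
    (ht : (U t, t) ∈ coefficientRectangle u₁ u₂ w₁ w₂) :
    curveCoefficient c u₁ u₂ hw U t = c (U t) t := by
  have h1 : U t ∈ Icc (u₁ ⊓ u₂) (u₁ ⊔ u₂) := ht.1
  simp [curveCoefficient, projIcc_of_mem hw ht.2, projIcc_of_mem inf_le_sup h1]

lemma continuous_curveCoefficient {c : ℝ → ℝ → ℝ}
    (hc : ContinuousOn (fun p : ℝ × ℝ => c p.1 p.2) (coefficientRectangle u₁ u₂ w₁ w₂))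
    (hw : w₁ ≤ w₂) {U : ℝ → ℝ} (hU : ContinuousOn U (Icc w₁ w₂)) :
    Continuous (curveCoefficient c u₁ u₂ hw U) := by
  have h1 : Continuous fun t : ℝ => (projIcc w₁ w₂ hw t : ℝ) :=
    continuous_subtype_val.comp continuous_projIcc
  have h2 : Continuous fun t : ℝ => U (projIcc w₁ w₂ hw t) :=
    hU.comp_continuous h1 fun t => Subtype.coe_prop _
  have h3 : Continuous fun t : ℝ =>
      (projIcc (u₁ ⊓ u₂) (u₁ ⊔ u₂) inf_le_sup (U (projIcc w₁ w₂ hw t)) : ℝ) :=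
    continuous_subtype_val.comp (continuous_projIcc.comp h2)
  exact hc.comp_continuous (h3.prodMk h1) fun t => curveCoefficient_mem hw U t

lemma curveCoefficient_congr (c : ℝ → ℝ → ℝ) (hw : w₁ ≤ w₂) {U U' : ℝ → ℝ}
    (h : EqOn U U' (Icc w₁ w₂)) :
    curveCoefficient c u₁ u₂ hw U = curveCoefficient c u₁ u₂ hw U' := by
  funext t
  simp only [curveCoefficient, h (Subtype.coe_prop (projIcc w₁ w₂ hw t))]

/-- A continuously differentiable function on a closed interval, extended to the line by constant
values of its derivative. -/
lemma exists_hasDerivAt_eqOn_Icc (hw : w₁ < w₂) {U : ℝ → ℝ}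
    (hU : ContDiffOn ℝ 1 U (Icc w₁ w₂)) :
    ∃ V f : ℝ → ℝ, Continuous f ∧ (∀ t, HasDerivAt V (f t) t) ∧ EqOn V U (Icc w₁ w₂) := by
  have hcd : ContinuousOn (derivWithin U (Icc w₁ w₂)) (Icc w₁ w₂) :=
    hU.continuousOn_derivWithin (uniqueDiffOn_Icc hw) le_rfl
  set f : ℝ → ℝ := fun t => derivWithin U (Icc w₁ w₂) (projIcc w₁ w₂ hw.le t) with hf
  have hfc : Continuous f := hcd.comp_continuous
    (continuous_subtype_val.comp continuous_projIcc) fun t => Subtype.coe_prop _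
  have hV : ∀ t, HasDerivAt (fun t => U w₁ + ∫ s in w₁..t, f s) (f t) t := fun t =>
    (hfc.integral_hasStrictDerivAt w₁ t).hasDerivAt.const_add _
  refine ⟨_, f, hfc, hV, ?_⟩
  have hUd : ∀ t ∈ Icc w₁ w₂, HasDerivWithinAt U (f t) (Icc w₁ w₂) t := fun t ht => by
    have := (hU.differentiableOn one_ne_zero t ht).hasDerivWithinAt
    simpa [hf, projIcc_of_mem hw.le ht] using this
  refine eq_of_has_deriv_right_eq (f' := f) (fun t _ => (hV t).hasDerivWithinAt)
    (fun t ht => (hUd t (Ico_subset_Icc_self ht)).mono_of_mem_nhdsWithin ?_)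
    (fun t _ => (hV t).continuousAt.continuousWithinAt) hU.continuousOn (by simp)
  exact mem_of_superset (Icc_mem_nhdsGE ht.2) (Icc_subset_Icc_left ht.1)

end Curve

/-! ### Functional solutions -/

section Functional

variable {N : ℕ} {Ω Γ₁ Γ₂ Γ₃ : Set (EuclideanSpace ℝ (Fin N))} {a b : ℝ → ℝ → ℝ}
  {u₁ u₂ w₁ w₂ : ℝ} {u w z : EuclideanSpace ℝ (Fin N) → ℝ}

/-- The potential `B(t) = ∫ b(U(s), s) ds`, based at `w₁`. -/
noncomputable def potential (b : ℝ → ℝ → ℝ) (u₁ u₂ : ℝ) (hw : w₁ ≤ w₂) (U : ℝ → ℝ) (t : ℝ) : ℝ :=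
  ∫ s in w₁..t, curveCoefficient b u₁ u₂ hw U s

lemma potential_left (hw : w₁ ≤ w₂) (U : ℝ → ℝ) : potential b u₁ u₂ hw U w₁ = 0 := by
  simp [potential]

lemma hasDerivAt_potential
    (hb : ContinuousOn (fun p : ℝ × ℝ => b p.1 p.2) (coefficientRectangle u₁ u₂ w₁ w₂))
    (hw : w₁ ≤ w₂) {U : ℝ → ℝ} (hU : ContinuousOn U (Icc w₁ w₂)) (t : ℝ) :
    HasDerivAt (potential b u₁ u₂ hw U) (curveCoefficient b u₁ u₂ hw U t) t :=
  ((continuous_curveCoefficient hb hw hU).integral_hasStrictDerivAt w₁ t).hasDerivAt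

lemma strictMono_potential
    (hb : ContinuousOn (fun p : ℝ × ℝ => b p.1 p.2) (coefficientRectangle u₁ u₂ w₁ w₂))
    (hb_pos : ∀ p ∈ coefficientRectangle u₁ u₂ w₁ w₂, 0 < b p.1 p.2)
    (hw : w₁ ≤ w₂) {U : ℝ → ℝ} (hU : ContinuousOn U (Icc w₁ w₂)) :
    StrictMono (potential b u₁ u₂ hw U) :=
  strictMono_of_deriv_pos fun t => by
    rw [(hasDerivAt_potential hb hw hU t).deriv]
    exact hb_pos _ (curveCoefficient_mem hw U t)

/-- The potential of the second flux is a multiple of the solution of the mixed problem. -/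
lemma IsClassicalSolution.potential_eq (hΩ : IsOpen Ω)
    (hmixed : MixedProblemUniquelySolvable Ω Γ₁ Γ₂ Γ₃) (hz : IsMixedSolution Ω Γ₁ Γ₂ Γ₃ z)
    (hb : ContinuousOn (fun p : ℝ × ℝ => b p.1 p.2) (coefficientRectangle u₁ u₂ w₁ w₂))
    (hw : w₁ ≤ w₂) (h : IsClassicalSolution Ω Γ₁ Γ₂ Γ₃ a b u₁ u₂ w₁ w₂ u w) {U : ℝ → ℝ}
    (hU : ContinuousOn U (Icc w₁ w₂)) (huU : ∀ x ∈ closure Ω, u x = U (w x)) :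
    ∀ x ∈ closure Ω,
      potential b u₁ u₂ hw U (w x) = potential b u₁ u₂ hw U w₂ * z x := by
  have hB := hasDerivAt_potential hb hw hU
  obtain ⟨h1, h2⟩ := contDiffOn_comp_and_laplacian_comp_eq_zero hΩ hB h.contDiffOn_w
    h.contDiffOn_flux_w h.equation_w fun x hx => by
      have hx' := subset_closure hx
      have hm := h.mem_rectangle x hx'
      rw [huU x hx'] at hm
      rw [flux, curveCoefficient_of_mem hw hm, huU x hx']
  intro x hx
  have hBc : Continuous (potential b u₁ u₂ hw U) :=
    continuous_iff_continuousAt.2 fun t => (hB t).continuousAt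
  have := hmixed.eqOn_affine hΩ hz (hBc.comp_continuousOn h.continuousOn_w) h1 h2
    (h.boundary_w.comp hB) x hx
  simpa [potential_left] using this

/-- If `z` attains every value in `[0, 1]`, then `u = U(w)` forces `U` to solve the two-point
problem. -/
lemma IsClassicalSolution.isTwoPointSolution (hΩ : IsOpen Ω)
    (hΓ₁ : Γ₁ ⊆ closure Ω) (hΓ₂ : Γ₂ ⊆ closure Ω) (hΓ₃ : Γ₃ ⊆ closure Ω)
    (hmixed : MixedProblemUniquelySolvable Ω Γ₁ Γ₂ Γ₃) (hz : IsMixedSolution Ω Γ₁ Γ₂ Γ₃ z)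
    (hsurj : ∀ c ∈ Icc (0 : ℝ) 1, ∃ x ∈ closure Ω, z x = c)
    (ha : ContinuousOn (fun p : ℝ × ℝ => a p.1 p.2) (coefficientRectangle u₁ u₂ w₁ w₂))
    (hb : ContinuousOn (fun p : ℝ × ℝ => b p.1 p.2) (coefficientRectangle u₁ u₂ w₁ w₂))
    (ha_pos : ∀ p ∈ coefficientRectangle u₁ u₂ w₁ w₂, 0 < a p.1 p.2)
    (hb_pos : ∀ p ∈ coefficientRectangle u₁ u₂ w₁ w₂, 0 < b p.1 p.2)
    (hw : w₁ < w₂) (h : IsClassicalSolution Ω Γ₁ Γ₂ Γ₃ a b u₁ u₂ w₁ w₂ u w) {U : ℝ → ℝ}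
    (hU : ContDiffOn ℝ 1 U (Icc w₁ w₂)) (huU : ∀ x ∈ closure Ω, u x = U (w x)) :
    ∃ γ : ℝ, IsTwoPointSolution a b u₁ u₂ w₁ w₂ γ U := by
  have hpot := h.potential_eq hΩ hmixed hz hb hw.le hU.continuousOn huU
  have hB := hasDerivAt_potential hb hw.le hU.continuousOn
  have hBmono := strictMono_potential hb hb_pos hw.le hU.continuousOn
  set B := potential b u₁ u₂ hw.le U
  have hB1 : B w₁ = 0 := potential_left hw.le U
  have hβ : 0 < B w₂ := hB1 ▸ hBmono hw
  have hwsurj : ∀ t ∈ Icc w₁ w₂, ∃ x ∈ closure Ω, w x = t := by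
    intro t ht
    have h0 : 0 ≤ B t := hB1 ▸ hBmono.monotone ht.1
    obtain ⟨x, hx, hzx⟩ := hsurj (B t / B w₂)
      ⟨div_nonneg h0 hβ.le, (div_le_one hβ).2 (hBmono.monotone ht.2)⟩
    refine ⟨x, hx, hBmono.injective ?_⟩
    rw [hpot x hx, hzx, mul_div_cancel₀ _ hβ.ne']
  have hmem : ∀ t ∈ Icc w₁ w₂, (U t, t) ∈ coefficientRectangle u₁ u₂ w₁ w₂ := by
    intro t ht
    obtain ⟨x, hx, rfl⟩ := hwsurj t ht
    rw [← huU x hx]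
    exact h.mem_rectangle x hx
  obtain ⟨V, f, hfc, hV, hVU⟩ := exists_hasDerivAt_eqOn_Icc hw hU
  -- The potential of the first flux.
  set A : ℝ → ℝ := fun t => ∫ s in w₁..t, curveCoefficient a u₁ u₂ hw.le U s * f s with hAdef
  have hA : ∀ t, HasDerivAt A (curveCoefficient a u₁ u₂ hw.le U t * f t) t := fun t =>
    (((continuous_curveCoefficient ha hw.le hU.continuousOn).mul hfc).integral_hasStrictDerivAt
      w₁ t).hasDerivAt
  have hA1 : A w₁ = 0 := by simp [hAdef]
  have hgrad : ∀ x ∈ Ω,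
      (curveCoefficient a u₁ u₂ hw.le U (w x) * f (w x)) • gradient w x = flux a u w u x := by
    intro x hx
    have hx' := subset_closure hx
    have hm := h.mem_rectangle x hx'
    have hdw : DifferentiableAt ℝ w x :=
      (h.contDiffOn_w.differentiableOn one_ne_zero).differentiableAt (hΩ.mem_nhds hx)
    have he : u =ᶠ[𝓝 x] V ∘ w := by
      filter_upwards [hΩ.mem_nhds hx] with y hy
      have hy' := subset_closure hy
      rw [huU y hy', Function.comp_apply, hVU (h.mem_rectangle y hy').2]
    have hgu : gradient u x = f (w x) • gradient w x := by
      have h2 := (hV (w x)).comp_hasFDerivAt x hdw.hasFDerivAt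
      rw [← toDual_gradient, ← map_smul] at h2
      rw [he.gradient_eq]
      exact (hasGradientAt_iff_hasFDerivAt.2 h2).gradient
    rw [huU x hx'] at hm
    rw [flux, hgu, curveCoefficient_of_mem hw.le hm, huU x hx', mul_smul]
  obtain ⟨hA2, hAΔ⟩ := contDiffOn_comp_and_laplacian_comp_eq_zero hΩ hA h.contDiffOn_w
    h.contDiffOn_flux_u h.equation_u hgrad
  have hAc : Continuous A := continuous_iff_continuousAt.2 fun t => (hA t).continuousAt
  have hAz := hmixed.eqOn_affine hΩ hz (hAc.comp_continuousOn h.continuousOn_w) hA2 hAΔ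
    (h.boundary_w.comp hA)
  have hAB : ∀ t ∈ Icc w₁ w₂, A t = A w₂ / B w₂ * B t := by
    intro t ht
    obtain ⟨x, hx, rfl⟩ := hwsurj t ht
    have h1 := hAz x hx
    simp only [Function.comp_apply, hA1, zero_add, sub_zero] at h1
    rw [h1, hpot x hx]
    field_simp
  refine ⟨A w₂ / B w₂, hmem, hU, fun t ht => ?_, ?_, ?_⟩
  · have hUt : HasDerivWithinAt U (f t) (Icc w₁ w₂) t :=
      (hV t).hasDerivWithinAt.congr (fun s hs => (hVU hs).symm) (hVU ht).symm
    have hd1 : HasDerivWithinAt A (A w₂ / B w₂ * curveCoefficient b u₁ u₂ hw.le U t)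
        (Icc w₁ w₂) t :=
      ((hB t).const_mul (A w₂ / B w₂)).hasDerivWithinAt.congr hAB (hAB t ht)
    have he := ((uniqueDiffOn_Icc hw).uniqueDiffWithinAt ht).eq_deriv _
      (hA t).hasDerivWithinAt hd1
    rw [curveCoefficient_of_mem hw.le (hmem t ht), curveCoefficient_of_mem hw.le (hmem t ht)] at he
    have hat : 0 < a (U t) t := ha_pos _ (hmem t ht)
    convert hUt using 1
    rw [← mul_div_assoc, ← he, mul_div_cancel_left₀ _ hat.ne']
  · obtain ⟨x, hx, hx0⟩ := hsurj 0 (by simp)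
    obtain ⟨y, hy⟩ := hmixed.nonempty_first hΩ hΓ₃ hz hx hx0
    rw [← h.boundary_w.on_first y hy, ← huU y (hΓ₁ hy), h.boundary_u.on_first y hy]
  · obtain ⟨x, hx, hx1⟩ := hsurj 1 (by simp)
    obtain ⟨y, hy⟩ := hmixed.nonempty_second hΩ hΓ₃ hz hx hx1
    rw [← h.boundary_w.on_second y hy, ← huU y (hΓ₂ hy), h.boundary_u.on_second y hy]

/-- Where `z = 0`, a functional solution has the values prescribed on `Γ₁`. -/
lemma IsFunctionalSolution.eq_first (hΩ : IsOpen Ω) (hΓ₁ : Γ₁ ⊆ closure Ω)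
    (hΓ₃ : Γ₃ ⊆ closure Ω)
    (hmixed : MixedProblemUniquelySolvable Ω Γ₁ Γ₂ Γ₃) (hz : IsMixedSolution Ω Γ₁ Γ₂ Γ₃ z)
    (hb : ContinuousOn (fun p : ℝ × ℝ => b p.1 p.2) (coefficientRectangle u₁ u₂ w₁ w₂))
    (hb_pos : ∀ p ∈ coefficientRectangle u₁ u₂ w₁ w₂, 0 < b p.1 p.2)
    (hw : w₁ ≤ w₂) (h : IsFunctionalSolution Ω Γ₁ Γ₂ Γ₃ a b u₁ u₂ w₁ w₂ u w)
    {x : EuclideanSpace ℝ (Fin N)} (hx : x ∈ closure Ω) (h0 : z x = 0) :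
    u x = u₁ ∧ w x = w₁ := by
  obtain ⟨hs, U, hU, huU⟩ := h
  have hwx : w x = w₁ := (strictMono_potential hb hb_pos hw hU.continuousOn).injective <| by
    rw [hs.potential_eq hΩ hmixed hz hb hw hU.continuousOn huU x hx, h0, mul_zero,
      potential_left]
  obtain ⟨y, hy⟩ := hmixed.nonempty_first hΩ hΓ₃ hz hx h0
  refine ⟨?_, hwx⟩
  rw [huU x hx, hwx, ← hs.boundary_w.on_first y hy, ← huU y (hΓ₁ hy), hs.boundary_u.on_first y hy]

/-- Where `z = 1`, a functional solution has the values prescribed on `Γ₂`. -/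
lemma IsFunctionalSolution.eq_second (hΩ : IsOpen Ω) (hΓ₂ : Γ₂ ⊆ closure Ω)
    (hΓ₃ : Γ₃ ⊆ closure Ω)
    (hmixed : MixedProblemUniquelySolvable Ω Γ₁ Γ₂ Γ₃) (hz : IsMixedSolution Ω Γ₁ Γ₂ Γ₃ z)
    (hb : ContinuousOn (fun p : ℝ × ℝ => b p.1 p.2) (coefficientRectangle u₁ u₂ w₁ w₂))
    (hb_pos : ∀ p ∈ coefficientRectangle u₁ u₂ w₁ w₂, 0 < b p.1 p.2)
    (hw : w₁ ≤ w₂) (h : IsFunctionalSolution Ω Γ₁ Γ₂ Γ₃ a b u₁ u₂ w₁ w₂ u w)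
    {x : EuclideanSpace ℝ (Fin N)} (hx : x ∈ closure Ω) (h1 : z x = 1) :
    u x = u₂ ∧ w x = w₂ := by
  obtain ⟨hs, U, hU, huU⟩ := h
  have hwx : w x = w₂ := (strictMono_potential hb hb_pos hw hU.continuousOn).injective <| by
    rw [hs.potential_eq hΩ hmixed hz hb hw hU.continuousOn huU x hx, h1, mul_one]
  obtain ⟨y, hy⟩ := hmixed.nonempty_second hΩ hΓ₃ hz hx h1
  refine ⟨?_, hwx⟩
  rw [huU x hx, hwx, ← hs.boundary_w.on_second y hy, ← huU y (hΓ₂ hy),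
    hs.boundary_u.on_second y hy]

end Functional

theorem mainTheorem4 {N : ℕ} (Ω Γ₁ Γ₂ Γ₃ : Set (EuclideanSpace ℝ (Fin N)))
    (hΩ_open : IsOpen Ω) (hΩ_bdd : Bornology.IsBounded Ω)
    (hΓ : Γ₁ ∪ Γ₂ ∪ Γ₃ = frontier Ω)
    (hΓ₁₂ : Disjoint Γ₁ Γ₂) (hΓ₁₃ : Disjoint Γ₁ Γ₃) (hΓ₂₃ : Disjoint Γ₂ Γ₃)
    (hmixed : MixedProblemUniquelySolvable Ω Γ₁ Γ₂ Γ₃)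
    (u₁ u₂ w₁ w₂ : ℝ) (hw : w₁ < w₂) (a b : ℝ → ℝ → ℝ)
    (ha_cont : ContinuousOn (fun p : ℝ × ℝ => a p.1 p.2) (coefficientRectangle u₁ u₂ w₁ w₂))
    (hb_cont : ContinuousOn (fun p : ℝ × ℝ => b p.1 p.2) (coefficientRectangle u₁ u₂ w₁ w₂))
    (ha_pos : ∀ p ∈ coefficientRectangle u₁ u₂ w₁ w₂, 0 < a p.1 p.2)
    (hb_pos : ∀ p ∈ coefficientRectangle u₁ u₂ w₁ w₂, 0 < b p.1 p.2)
    (htwo : TwoPointProblemUniquelySolvable a b u₁ u₂ w₁ w₂)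
    (u w u' w' : EuclideanSpace ℝ (Fin N) → ℝ)
    (h : IsFunctionalSolution Ω Γ₁ Γ₂ Γ₃ a b u₁ u₂ w₁ w₂ u w)
    (h' : IsFunctionalSolution Ω Γ₁ Γ₂ Γ₃ a b u₁ u₂ w₁ w₂ u' w') :
    Set.EqOn u u' (closure Ω) ∧ Set.EqOn w w' (closure Ω) := by
  have hΓ₁ : Γ₁ ⊆ closure Ω := fun x hx =>
    frontier_subset_closure (hΓ ▸ Or.inl (Or.inl hx))
  have hΓ₂ : Γ₂ ⊆ closure Ω := fun x hx =>
    frontier_subset_closure (hΓ ▸ Or.inl (Or.inr hx))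
  have hΓ₃ : Γ₃ ⊆ closure Ω := fun x hx =>
    frontier_subset_closure (hΓ ▸ Or.inr hx)
  obtain ⟨z, hz, huniq⟩ := id hmixed
  by_cases hsurj : ∀ c ∈ Icc (0 : ℝ) 1, ∃ x ∈ closure Ω, z x = c
  · obtain ⟨hs, U, hU, huU⟩ := h
    obtain ⟨hs', U', hU', huU'⟩ := h'
    obtain ⟨γ, hγ⟩ := hs.isTwoPointSolution hΩ_open hΓ₁ hΓ₂ hΓ₃ hmixed hz hsurj ha_cont hb_cont
      ha_pos hb_pos hw hU huU
    obtain ⟨γ', hγ'⟩ := hs'.isTwoPointSolution hΩ_open hΓ₁ hΓ₂ hΓ₃ hmixed hz hsurj ha_cont hb_cont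
      ha_pos hb_pos hw hU' huU'
    obtain ⟨γ₀, U₀, -, h₀⟩ := htwo
    have hUU : EqOn U U' (Icc w₁ w₂) := (h₀ γ U hγ).2.trans (h₀ γ' U' hγ').2.symm
    have hww : EqOn w w' (closure Ω) := by
      intro x hx
      apply (strictMono_potential hb_cont hb_pos hw.le hU.continuousOn).injective
      have hpot : potential b u₁ u₂ hw.le U = potential b u₁ u₂ hw.le U' := by
        unfold potential
        rw [curveCoefficient_congr b hw.le hUU]
      rw [hs.potential_eq hΩ_open hmixed hz hb_cont hw.le hU.continuousOn huU x hx, hpot,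
        hs'.potential_eq hΩ_open hmixed hz hb_cont hw.le hU'.continuousOn huU' x hx]
    refine ⟨fun x hx => ?_, hww⟩
    rw [huU x hx, huU' x hx, ← hww hx]
    exact hUU (hs.mem_rectangle x hx).2
  · push Not at hsurj
    obtain ⟨c, hc, hne⟩ := hsurj
    have hstep := huniq _ (hz.step hΩ_open hΓ₃ hΓ₂ hc hne)
    have key : ∀ x ∈ closure Ω, u x = u' x ∧ w x = w' x := by
      intro x hx
      have hzx : z x = 0 ∨ z x = 1 := by
        rw [← hstep hx]
        dsimp only
        split_ifs <;> simp
      rcases hzx with h0 | h1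
      · obtain ⟨e1, e2⟩ := h.eq_first hΩ_open hΓ₁ hΓ₃ hmixed hz hb_cont hb_pos hw.le hx h0
        obtain ⟨e3, e4⟩ := h'.eq_first hΩ_open hΓ₁ hΓ₃ hmixed hz hb_cont hb_pos hw.le hx h0
        exact ⟨e1.trans e3.symm, e2.trans e4.symm⟩
      · obtain ⟨e1, e2⟩ := h.eq_second hΩ_open hΓ₂ hΓ₃ hmixed hz hb_cont hb_pos hw.le hx h1
        obtain ⟨e3, e4⟩ := h'.eq_second hΩ_open hΓ₂ hΓ₃ hmixed hz hb_cont hb_pos hw.le hx h1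
        exact ⟨e1.trans e3.symm, e2.trans e4.symm⟩
    exact ⟨fun x hx => (key x hx).1, fun x hx => (key x hx).2⟩
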